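/- For $n\ge 0$ let $\mathbb H^n=\{p\in\mathbb R^{1,n}:\langle p,p\rangle=-1,\ p_0>0\}$ be real hyperbolic space, where $\langle x,y\rangle=-x_0y_0+\sum_{i=1}^n x_iy_i$. Let $\mathbf h_n$ be the hyperbolic metric, i.e. the pullback of $\langle\cdot,\cdot\rangle$ to $\mathbb H^n$, and let $d(p,q)=\operatorname{arcosh}(-\langle p,q\rangle)$ be the hyperbolic distance. Let $\sigma_m$ be the round metric on the unit sphere $\mathbb S^m\subset\mathbb R^{m+1}$. Theorem. Let $0\le k<n$ and let $\iota:\mathbb H^k\to\mathbb H^n$ be a distance-preserving map, so that its image $Y=\iota(\mathbb H^k)$ is a totally geodesic copy of $\mathbb H^k$ in $\mathbb H^n$. Then $\mathbb H^n\setminus Y$ is open, and there is a diffeomorphism $$\Phi:(\mathbb H^k\times\mathbb S^{n-k-1})\times(0,\infty)\longrightarrow\mathbb H^n\setminus Y$$ such that, with $r$ denoting the coordinate on $(0,\infty)$, $$\Phi^*\mathbf h_n=\cosh^2(r)\,\mathbf h_k+\sinh^2(r)\,\sigma_{n-k-1}+dr^2 .$$ Moreover, $\Phi$ gives spherical coordinates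 about $Y$: for every point $(q,\theta,r)$, $r$ is the distance from $\Phi(q,\theta,r)$ to $Y$, and this distance is attained at $\iota(q)$, that is, $d(\Phi(q,\theta,r),\iota(q))=r\le d(\Phi(q,\theta,r),\iota(y))$ for all $y\in\mathbb H^k$. -/

import Mathlib

open scoped Manifold ContDiff

noncomputable section

/-- The Lorentzian inner product `-s t + ⟪x, y⟫` on `ℝ^{1,n} = ℝ × ℝⁿ`. -/
def lorentzForm (n : ℕ) : LinearMap.BilinForm ℝ (ℝ × EuclideanSpace ℝ (Fin n)) :=
  -(LinearMap.mul ℝ ℝ).compl₁₂ (LinearMap.fst ℝ ℝ _) (LinearMap.fst ℝ ℝ _)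
    + (innerₗ (EuclideanSpace ℝ (Fin n))).compl₁₂ (LinearMap.snd ℝ ℝ _) (LinearMap.snd ℝ ℝ _)

theorem lorentzForm_apply (n : ℕ) (v w : ℝ × EuclideanSpace ℝ (Fin n)) :
    lorentzForm n v w = -(v.1 * w.1) + inner ℝ v.2 w.2 := rfl

/-- Hyperbolic space `ℍⁿ`: the upper sheet of the hyperboloid `⟨p, p⟩ = -1` in `ℝ^{1,n}`. -/
def Hyp (n : ℕ) : Type :=
  {p : ℝ × EuclideanSpace ℝ (Fin n) // lorentzForm n p p = -1 ∧ 0 < p.1}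

namespace Hyp

variable {n : ℕ}

/-- The inclusion of `ℍⁿ` in `ℝ^{1,n}`. -/
def incl (p : Hyp n) : ℝ × EuclideanSpace ℝ (Fin n) := p.1

instance : TopologicalSpace (Hyp n) :=
  inferInstanceAs (TopologicalSpace {p : ℝ × EuclideanSpace ℝ (Fin n) //
    lorentzForm n p p = -1 ∧ 0 < p.1})

theorem fst_eq (p : Hyp n) : p.incl.1 = √(1 + ‖p.incl.2‖ ^ 2) := by
  have h := p.2.1
  have h0 := p.2.2
  rw [lorentzForm_apply, real_inner_self_eq_norm_sq] at h
  have h1 : 1 + ‖p.incl.2‖ ^ 2 = p.incl.1 * p.incl.1 := by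
    change 1 + ‖p.1.2‖ ^ 2 = p.1.1 * p.1.1
    linarith
  rw [h1]
  exact (Real.sqrt_mul_self h0.le).symm

/-- The hyperboloid is the graph of `x ↦ √(1 + ‖x‖²)`; projection to `ℝⁿ` is a homeomorphism. -/
def graphHomeo (n : ℕ) : Hyp n ≃ₜ EuclideanSpace ℝ (Fin n) where
  toFun p := p.incl.2
  invFun x := ⟨(√(1 + ‖x‖ ^ 2), x), by
    have h : (0 : ℝ) < 1 + ‖x‖ ^ 2 := by positivity
    refine ⟨?_, Real.sqrt_pos.2 h⟩
    rw [lorentzForm_apply, real_inner_self_eq_norm_sq, Real.mul_self_sqrt h.le]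
    ring⟩
  left_inv p := Subtype.ext (Prod.ext (fst_eq p).symm rfl)
  right_inv _ := rfl
  continuous_toFun := continuous_snd.comp continuous_subtype_val
  continuous_invFun := by
    refine Continuous.subtype_mk ?_ _
    fun_prop

/-- The smooth structure of `ℍⁿ`, given by the global chart `graphHomeo`. -/
instance : ChartedSpace (EuclideanSpace ℝ (Fin n)) (Hyp n) :=
  (graphHomeo n).toOpenPartialHomeomorph.singletonChartedSpace rfl

instance : IsManifold (𝓡 n) ∞ (Hyp n) :=
  (graphHomeo n).toOpenPartialHomeomorph.isManifold_singleton (I := 𝓡 n) rfl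

/-- The hyperbolic metric `hₙ`: the pullback of the Lorentzian inner product to the hyperboloid. -/
def metric (p : Hyp n) : LinearMap.BilinForm ℝ (TangentSpace (𝓡 n) p) :=
  (lorentzForm n).compl₁₂
    (mfderiv (𝓡 n) 𝓘(ℝ, ℝ × EuclideanSpace ℝ (Fin n)) (incl (n := n)) p).toLinearMap
    (mfderiv (𝓡 n) 𝓘(ℝ, ℝ × EuclideanSpace ℝ (Fin n)) (incl (n := n)) p).toLinearMap

/-- The hyperbolic distance, `cosh d(p, q) = -⟨p, q⟩`. -/
def hdist (p q : Hyp n) : ℝ := Real.arcosh (-lorentzForm n p.incl q.incl)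

/-- `ι : ℍᵏ → ℍⁿ` parametrizes a totally geodesic copy of `ℍᵏ` in `ℍⁿ`: it preserves the
hyperbolic distance. The images of these maps are exactly the complete (connected) totally
geodesic `k`-dimensional submanifolds of `ℍⁿ`. -/
def IsTotallyGeodesicCopy {k : ℕ} (ι : Hyp k → Hyp n) : Prop :=
  ∀ x y : Hyp k, hdist (ι x) (ι y) = hdist x y

end Hyp

/-- The unit sphere `𝕊ᵐ` in `ℝ^{m+1}`, with Mathlib's smooth structure. -/
abbrev USphere (m : ℕ) : Type := Metric.sphere (0 : EuclideanSpace ℝ (Fin (m + 1))) 1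

/-- The round metric `σₘ` on `𝕊ᵐ`: the pullback of the Euclidean inner product. -/
def roundMetric {m : ℕ} (θ : USphere m) : LinearMap.BilinForm ℝ (TangentSpace (𝓡 m) θ) :=
  (innerₗ (EuclideanSpace ℝ (Fin (m + 1)))).compl₁₂
    (mfderiv (𝓡 m) 𝓘(ℝ, EuclideanSpace ℝ (Fin (m + 1)))
      (fun x : USphere m => (x : EuclideanSpace ℝ (Fin (m + 1)))) θ).toLinearMap
    (mfderiv (𝓡 m) 𝓘(ℝ, EuclideanSpace ℝ (Fin (m + 1)))
      (fun x : USphere m => (x : EuclideanSpace ℝ (Fin (m + 1)))) θ).toLinearMap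

/-- The open half-line `(0, ∞)` as an open submanifold of `ℝ`. -/
abbrev PosLine : TopologicalSpace.Opens ℝ := ⟨Set.Ioi 0, isOpen_Ioi⟩

/-- The one-form `dr` on `(0, ∞)`: the differential of the coordinate function `r`. -/
def drForm (r : PosLine) : TangentSpace 𝓘(ℝ, ℝ) r →ₗ[ℝ] ℝ :=
  (mfderiv 𝓘(ℝ, ℝ) 𝓘(ℝ, ℝ) (fun s : PosLine => (s : ℝ)) r).toLinearMap

/-- The model with corners of `(ℍᵏ × 𝕊ᵐ) × (0, ∞)`. -/
abbrev sphModel (k m : ℕ) := ((𝓡 k).prod (𝓡 m)).prod 𝓘(ℝ, ℝ)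

/-- The metric `cosh²(r) hₖ + sinh²(r) σₘ + dr²` at a point of `(ℍᵏ × 𝕊ᵐ) × (0, ∞)`, each term
being pulled back along the projection to the corresponding factor. -/
def sphMetric (k m : ℕ) (p : (Hyp k × USphere m) × PosLine) :
    LinearMap.BilinForm ℝ (TangentSpace (sphModel k m) p) :=
  let dq := (mfderiv (sphModel k m) (𝓡 k)
    (fun z : (Hyp k × USphere m) × PosLine => z.1.1) p).toLinearMap
  let dθ := (mfderiv (sphModel k m) (𝓡 m)
    (fun z : (Hyp k × USphere m) × PosLine => z.1.2) p).toLinearMap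
  let dr := drForm p.2 ∘ₗ (mfderiv (sphModel k m) 𝓘(ℝ, ℝ)
    (fun z : (Hyp k × USphere m) × PosLine => z.2) p).toLinearMap
  Real.cosh (p.2 : ℝ) ^ 2 • (Hyp.metric p.1.1).compl₁₂ dq dq
    + Real.sinh (p.2 : ℝ) ^ 2 • (roundMetric p.1.2).compl₁₂ dθ dθ
    + (LinearMap.mul ℝ ℝ).compl₁₂ dr dr

end

/-! A distance-preserving `ι` preserves Lorentzian products, because `arcosh` is injective on `[1,
∞)`. It is therefore the restriction of a linear isometric embedding `ℝ^{1,k} → ℝ^{1,n}` (`linExt`).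
The orthogonal complement of the image is positive definite, so it is a Euclidean `ℝ^{m+1}` with `m
= n - k - 1`, and `exists_linearEquiv` gives an isometry `L : ℝ^{1,k} ⊕ ℝ^{m+1} ≃ ℝ^{1,n}` carrying
`(q, 0)` to `ι q`.

In this splitting `Φ(q, θ, r) = L (cosh r • q, sinh r • θ)`. A point `L (a, b)` of `ℍⁿ` satisfies
`-⟨a, a⟩ = 1 + ‖b‖²` and lies on `Y` iff `b = 0`; off `Y`, normalizing `a` and `b` inverts `Φ`
smoothly. The metric follows from the product rule, since `dq ⟂ q` and `dθ ⟂ θ`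
(`lorentzForm_mfderiv_tubeVec`). The distances follow from `cosh d(Φ(q, θ, r), ι y) = cosh r · cosh
d(q, y)` (`hdist_tubePoint`). -/

/-! ### Linear algebra of the Lorentzian form. -/

section Lorentz

variable {n : ℕ}

theorem lorentzForm_comm (v w : ℝ × EuclideanSpace ℝ (Fin n)) :
    lorentzForm n v w = lorentzForm n w v := by
  simp only [lorentzForm_apply, real_inner_comm, mul_comm]

theorem lorentzForm_eq_zero_of_forall {v : ℝ × EuclideanSpace ℝ (Fin n)}
    (h : ∀ w, lorentzForm n v w = 0) : v = 0 := by
  -- Pairing with the time reflection of `v` gives `v.1² + ‖v.2‖²`.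
  have := h (-v.1, v.2)
  rw [lorentzForm_apply, real_inner_self_eq_norm_sq] at this
  have h1 : v.1 = 0 := by nlinarith [sq_nonneg ‖v.2‖]
  have h2 : ‖v.2‖ = 0 := by simp_all
  exact Prod.ext h1 (norm_eq_zero.1 h2)

theorem lorentzForm_nondegenerate (n : ℕ) : (lorentzForm n).Nondegenerate :=
  ⟨fun _ h => lorentzForm_eq_zero_of_forall h,
    fun _ h => lorentzForm_eq_zero_of_forall fun w => (lorentzForm_comm _ w).trans (h w)⟩

/-- The Lorentzian form is positive definite on the orthogonal complement of a timelike vector. -/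
theorem lorentzForm_pos_of_orthogonal {t x : ℝ × EuclideanSpace ℝ (Fin n)}
    (ht : lorentzForm n t t = -1) (hx : lorentzForm n x t = 0) (h0 : x ≠ 0) :
    0 < lorentzForm n x x := by
  rw [lorentzForm_apply, real_inner_self_eq_norm_sq] at ht ⊢
  rw [lorentzForm_apply] at hx
  -- Orthogonality turns Cauchy-Schwarz into `x.1² (1 + ‖t.2‖²) ≤ ‖x.2‖² ‖t.2‖²`, which is
  -- incompatible with `0 < ‖x.2‖² ≤ x.1²`.
  have hcs := real_inner_mul_inner_self_le x.2 t.2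
  rw [real_inner_self_eq_norm_sq, real_inner_self_eq_norm_sq,
    show inner ℝ x.2 t.2 = x.1 * t.1 by linarith] at hcs
  have ht2 : t.1 * t.1 = 1 + ‖t.2‖ ^ 2 := by linarith
  rcases eq_or_ne x.2 0 with h2 | h2
  · rw [h2] at hcs
    exfalso
    have h3 : x.1 = 0 := by
      simp only [norm_zero] at hcs
      nlinarith [sq_nonneg ‖t.2‖, mul_nonneg (sq_nonneg x.1) (sq_nonneg ‖t.2‖)]
    exact h0 (Prod.ext h3 h2)
  · have hp : 0 < ‖x.2‖ ^ 2 := by positivity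
    by_contra hc
    have h4 : ‖x.2‖ ^ 2 ≤ x.1 * x.1 := by linarith
    have h5 : ‖x.2‖ ^ 2 * (1 + ‖t.2‖ ^ 2) ≤ x.1 * x.1 * (1 + ‖t.2‖ ^ 2) :=
      mul_le_mul_of_nonneg_right h4 (by positivity)
    have h6 : x.1 * x.1 * (1 + ‖t.2‖ ^ 2) = x.1 * t.1 * (x.1 * t.1) := by rw [← ht2]; ring
    nlinarith

end Lorentz

/-! ### Linear extension of a distance-preserving map. -/

namespace Hyp

variable {n : ℕ}

theorem incl_injective : Function.Injective (incl (n := n)) := Subtype.val_injective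

theorem lorentzForm_self (p : Hyp n) : lorentzForm n p.incl p.incl = -1 := p.2.1

theorem fst_pos (p : Hyp n) : 0 < p.incl.1 := p.2.2

/-- The reversed Cauchy-Schwarz inequality. -/
theorem one_le_neg_lorentzForm (p q : Hyp n) : 1 ≤ -lorentzForm n p.incl q.incl := by
  rw [lorentzForm_apply]
  have h := real_inner_le_norm p.incl.2 q.incl.2
  have hp := p.lorentzForm_self
  have hq := q.lorentzForm_self
  rw [lorentzForm_apply, real_inner_self_eq_norm_sq] at hp hq
  have := norm_nonneg p.incl.2
  have := norm_nonneg q.incl.2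
  have h3 : 1 + ‖p.incl.2‖ * ‖q.incl.2‖ ≤ p.incl.1 * q.incl.1 := by
    refine abs_le_of_sq_le_sq' ?_ (mul_pos p.fst_pos q.fst_pos).le |>.2
    have : (p.incl.1 * q.incl.1) ^ 2 = (1 + ‖p.incl.2‖ ^ 2) * (1 + ‖q.incl.2‖ ^ 2) := by
      rw [show 1 + ‖p.incl.2‖ ^ 2 = p.incl.1 * p.incl.1 by linarith,
        show 1 + ‖q.incl.2‖ ^ 2 = q.incl.1 * q.incl.1 by linarith]
      ring
    rw [this]
    nlinarith [sq_nonneg (‖p.incl.2‖ - ‖q.incl.2‖)]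
  linarith

/-- A unit timelike vector lies on one of the two sheets of the hyperboloid. -/
theorem exists_incl_eq_or_eq_neg {v : ℝ × EuclideanSpace ℝ (Fin n)}
    (hv : lorentzForm n v v = -1) : ∃ p : Hyp n, p.incl = v ∨ p.incl = -v := by
  have h0 : v.1 ≠ 0 := by
    intro h
    rw [lorentzForm_apply, h, real_inner_self_eq_norm_sq] at hv
    nlinarith [sq_nonneg ‖v.2‖]
  rcases h0.lt_or_gt with h | h
  · exact ⟨⟨-v, by simpa using hv, by simpa using h⟩, Or.inr rfl⟩
  · exact ⟨⟨v, hv, h⟩, Or.inl rfl⟩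

/-- On the lower sheet, the reversed Cauchy-Schwarz inequality for `-v` and `q` would make the
product at least `1`. -/
theorem fst_pos_of_lorentzForm_neg {v : ℝ × EuclideanSpace ℝ (Fin n)}
    (hv : lorentzForm n v v = -1) (q : Hyp n) (hq : lorentzForm n v q.incl < 0) : 0 < v.1 := by
  obtain ⟨p, rfl | hp⟩ := exists_incl_eq_or_eq_neg hv
  · exact p.fst_pos
  · have := one_le_neg_lorentzForm p q
    rw [hp, map_neg, LinearMap.neg_apply] at this
    linarith

/-- The vertex `(1, 0)` of the hyperboloid. -/
def vertex (n : ℕ) : Hyp n := ⟨(1, 0), by simp [lorentzForm_apply], one_pos⟩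

/-- The point `(√2, eᵢ)` of the hyperboloid. -/
noncomputable def axisPoint (i : Fin n) : Hyp n :=
  ⟨(√2, EuclideanSpace.single i 1), by
    rw [lorentzForm_apply]
    simp
    norm_num, by positivity⟩

theorem lorentzForm_vertex (w : ℝ × EuclideanSpace ℝ (Fin n)) :
    lorentzForm n (vertex n).incl w = -w.1 := by
  simp [lorentzForm_apply, vertex, incl]

theorem lorentzForm_axisPoint (i : Fin n) (q : Hyp n) :
    lorentzForm n (axisPoint i).incl q.incl = -(√2 * q.incl.1) + q.incl.2 i := by
  simp [lorentzForm_apply, axisPoint, incl, EuclideanSpace.inner_single_left]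

variable {k : ℕ} {ι : Hyp k → Hyp n}

theorem IsTotallyGeodesicCopy.lorentzForm_eq (hι : IsTotallyGeodesicCopy ι) (x y : Hyp k) :
    lorentzForm n (ι x).incl (ι y).incl = lorentzForm k x.incl y.incl :=
  neg_injective (Real.arcosh_injOn (one_le_neg_lorentzForm _ _) (one_le_neg_lorentzForm _ _)
    (hι x y))

/-- The linear map `ℝ^{1,k} → ℝ^{1,n}` with the same values as `ι` at `(1, 0)` and `(√2, eᵢ)`. -/
noncomputable def linExt (ι : Hyp k → Hyp n) :
    (ℝ × EuclideanSpace ℝ (Fin k)) →ₗ[ℝ] (ℝ × EuclideanSpace ℝ (Fin n)) :=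
  (LinearMap.fst ℝ ℝ _).smulRight (ι (vertex k)).incl
    + ∑ i : Fin k, ((EuclideanSpace.proj i : _ →L[ℝ] ℝ).toLinearMap ∘ₗ
        LinearMap.snd ℝ ℝ (EuclideanSpace ℝ (Fin k))).smulRight
      ((ι (axisPoint i)).incl - √2 • (ι (vertex k)).incl)

/-- The vectors `(1, 0)` and `(√2, eᵢ) - √2 • (1, 0)` form the standard basis of `ℝ^{1,k}`. -/
theorem linExt_apply (ι : Hyp k → Hyp n) (v : ℝ × EuclideanSpace ℝ (Fin k)) :
    linExt ι v = v.1 • (ι (vertex k)).incl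
      + ∑ i, v.2 i • ((ι (axisPoint i)).incl - √2 • (ι (vertex k)).incl) := by
  simp [linExt]

/-- Both sides are linear in `v`, and on the basis they agree because `ι` preserves products. The
second slot must stay on `ι q` until `linExt_incl` identifies it with `linExt ι q.incl`. -/
theorem IsTotallyGeodesicCopy.lorentzForm_linExt_incl (hι : IsTotallyGeodesicCopy ι)
    (v : ℝ × EuclideanSpace ℝ (Fin k)) (q : Hyp k) :
    lorentzForm n (linExt ι v) (ι q).incl = lorentzForm k v q.incl := by
  rw [linExt_apply, map_add, map_sum, LinearMap.add_apply, LinearMap.sum_apply, lorentzForm_apply k,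
    PiLp.inner_apply]
  simp only [map_smul, map_sub, LinearMap.smul_apply, LinearMap.sub_apply, hι.lorentzForm_eq,
    lorentzForm_vertex, lorentzForm_axisPoint, smul_eq_mul]
  congr 1
  · ring
  · refine Finset.sum_congr rfl fun i _ => ?_
    simp only [RCLike.inner_apply, conj_trivial]
    ring

theorem IsTotallyGeodesicCopy.lorentzForm_linExt (hι : IsTotallyGeodesicCopy ι)
    (v w : ℝ × EuclideanSpace ℝ (Fin k)) :
    lorentzForm n (linExt ι v) (linExt ι w) = lorentzForm k v w := by
  rw [linExt_apply ι w, map_add, map_sum, lorentzForm_apply k v w, PiLp.inner_apply]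
  simp only [map_smul, map_sub, hι.lorentzForm_linExt_incl, smul_eq_mul]
  simp only [lorentzForm_comm v, lorentzForm_apply k (vertex k).incl,
    lorentzForm_apply k (axisPoint _).incl]
  simp only [vertex, axisPoint, incl, EuclideanSpace.inner_single_left, inner_zero_left]
  congr 1
  · ring
  · refine Finset.sum_congr rfl fun i _ => ?_
    simp only [RCLike.inner_apply, conj_trivial, map_one]
    ring

/-- The difference of the two sides is orthogonal to the timelike vector `ι q` and has Lorentzian
square `-1 + 2 - 1 = 0`, so it vanishes by positivity on that complement. -/
theorem IsTotallyGeodesicCopy.linExt_incl (hι : IsTotallyGeodesicCopy ι) (q : Hyp k) :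
    linExt ι q.incl = (ι q).incl := by
  by_contra h
  have h1 := lorentzForm_pos_of_orthogonal (x := linExt ι q.incl - (ι q).incl)
    (ι q).lorentzForm_self (by
      rw [map_sub, LinearMap.sub_apply, hι.lorentzForm_linExt_incl, lorentzForm_self,
        lorentzForm_self, sub_self]) (sub_ne_zero.2 h)
  simp only [map_sub, LinearMap.sub_apply, hι.lorentzForm_linExt, lorentzForm_self,
    hι.lorentzForm_linExt_incl, lorentzForm_comm (ι q).incl] at h1
  linarith

theorem IsTotallyGeodesicCopy.linExt_injective (hι : IsTotallyGeodesicCopy ι) :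
    Function.Injective (linExt ι) := by
  rw [← LinearMap.ker_eq_bot, LinearMap.ker_eq_bot']
  intro v hv
  refine lorentzForm_eq_zero_of_forall fun w => ?_
  rw [← hι.lorentzForm_linExt, hv, map_zero, LinearMap.zero_apply]

end Hyp

/-! ### Splitting of `ℝ^{1,n}` along the geodesic copy. -/

/-- A finite-dimensional real vector space with a positive definite symmetric bilinear form is
isometric to Euclidean space. -/
theorem LinearMap.BilinForm.exists_euclidean_isometry {V : Type*} [AddCommGroup V] [Module ℝ V]
    [FiniteDimensional ℝ V] (B : LinearMap.BilinForm ℝ V) (hs : ∀ x y, B x y = B y x)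
    (hp : ∀ x, x ≠ 0 → 0 < B x x) {m : ℕ} (hm : Module.finrank ℝ V = m) :
    ∃ T : EuclideanSpace ℝ (Fin m) →ₗ[ℝ] V, ∀ x y, B (T x) (T y) = inner ℝ x y := by
  have h0 : ∀ x, 0 ≤ B x x := fun x => by
    rcases eq_or_ne x 0 with rfl | h
    · simp
    · exact (hp x h).le
  let core : InnerProductSpace.Core ℝ V :=
    { inner := fun x y => B x y
      conj_inner_symm := fun x y => hs y x
      re_inner_nonneg := fun x => h0 x
      definite := fun x hx => by
        by_contra h
        exact (hp x h).ne' hx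
      add_left := fun x y z => by simp
      smul_left := fun x y r => by simp }
  let _ : NormedAddCommGroup V := core.toNormedAddCommGroup
  let _ : InnerProductSpace ℝ V := InnerProductSpace.ofCore core.toCore
  let b := (stdOrthonormalBasis ℝ V).reindex (finCongr hm)
  exact ⟨b.repr.symm.toLinearEquiv.toLinearMap, fun x y => b.repr.symm.inner_map_map x y⟩

theorem Hyp.IsTotallyGeodesicCopy.exists_linearEquiv {n k m : ℕ} (hm : k + (m + 1) = n)
    {ι : Hyp k → Hyp n} (hι : Hyp.IsTotallyGeodesicCopy ι) :
    ∃ L : ((ℝ × EuclideanSpace ℝ (Fin k)) × EuclideanSpace ℝ (Fin (m + 1))) ≃ₗ[ℝ]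
        (ℝ × EuclideanSpace ℝ (Fin n)),
      (∀ q : Hyp k, L (q.incl, 0) = (ι q).incl) ∧
      ∀ x y, lorentzForm n (L x) (L y) = lorentzForm k x.1 y.1 + inner ℝ x.2 y.2 := by
  let W := LinearMap.range (Hyp.linExt ι)
  let V := (lorentzForm n).orthogonal W
  have hV : ∀ x ∈ V, ∀ v, lorentzForm n (Hyp.linExt ι v) x = 0 := fun x hx v =>
    hx _ (LinearMap.mem_range_self _ v)
  have hdim : Module.finrank ℝ V = m + 1 := by
    have h := LinearMap.BilinForm.finrank_orthogonal (lorentzForm_nondegenerate n) W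
    have h' : Module.finrank ℝ W = k + 1 := by
      rw [LinearMap.finrank_range_of_inj hι.linExt_injective]
      simp [add_comm]
    change Module.finrank ℝ V = _ at h
    rw [h, h']
    simp
    omega
  -- `V` is positive definite because it is orthogonal to the timelike vector `ι (vertex k)`, which
  -- lies in `W`.
  obtain ⟨T, hT⟩ := ((lorentzForm n).restrict V).exists_euclidean_isometry
    (fun x y => lorentzForm_comm _ _)
    (fun x hx => lorentzForm_pos_of_orthogonal (ι (Hyp.vertex k)).lorentzForm_self
      (by rw [lorentzForm_comm, ← hι.linExt_incl]; exact hV x x.2 _)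
      (by simpa using hx)) hdim
  let L₀ := (Hyp.linExt ι).coprod (V.subtype ∘ₗ T)
  have hL : ∀ x y, lorentzForm n (L₀ x) (L₀ y) = lorentzForm k x.1 y.1 + inner ℝ x.2 y.2 := by
    intro x y
    have h1 := hT x.2 y.2
    rw [LinearMap.BilinForm.restrict_apply] at h1
    simp only [L₀, LinearMap.coprod_apply, map_add, LinearMap.add_apply, LinearMap.comp_apply,
      Submodule.subtype_apply, hι.lorentzForm_linExt, hV _ (T _).2,
      lorentzForm_comm (T x.2 : ℝ × EuclideanSpace ℝ (Fin n)) (Hyp.linExt ι _)]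
    rw [← h1]
    simp
  -- An isometry from a nondegenerate form is injective; equality of dimensions then makes it an
  -- equivalence.
  have hinj : Function.Injective L₀ := by
    rw [← LinearMap.ker_eq_bot, LinearMap.ker_eq_bot']
    intro x hx
    have h : ∀ y : (ℝ × EuclideanSpace ℝ (Fin k)) × EuclideanSpace ℝ (Fin (m + 1)),
        lorentzForm k x.1 y.1 + inner ℝ x.2 y.2 = 0 := fun y => by
      rw [← hL, hx, map_zero, LinearMap.zero_apply]
    refine Prod.ext (lorentzForm_eq_zero_of_forall fun w => ?_) ?_
    · simpa using h (w, 0)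
    · simpa using h (0, x.2)
  refine ⟨LinearEquiv.ofInjectiveOfFinrankEq L₀ hinj (by simp; omega), fun q => ?_, hL⟩
  change L₀ _ = _
  simp [L₀, hι.linExt_incl]

/-! ### Smoothness and tangent vectors of the hyperboloid. -/

namespace Hyp

variable {n k m : ℕ}

theorem contMDiff_incl_snd :
    ContMDiff (𝓡 n) 𝓘(ℝ, EuclideanSpace ℝ (Fin n)) ∞ (fun p : Hyp n => p.incl.2) := by
  intro p
  exact (contMDiffOn_chart (I := 𝓡 n) (n := ∞) (x := p)).contMDiffAt Filter.univ_mem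

theorem contMDiff_incl :
    ContMDiff (𝓡 n) 𝓘(ℝ, ℝ × EuclideanSpace ℝ (Fin n)) ∞ (incl (n := n)) := by
  have h : ContDiff ℝ ∞ (fun x : EuclideanSpace ℝ (Fin n) => ((√(1 + ‖x‖ ^ 2), x) : ℝ × _)) := by
    refine ContDiff.prodMk (ContDiff.sqrt ?_ fun x => by positivity) contDiff_id
    exact contDiff_const.add (contDiff_norm_sq ℝ)
  refine (h.contMDiff.comp contMDiff_incl_snd).congr fun p => ?_
  exact Prod.ext p.fst_eq rfl

theorem continuous_incl : Continuous (incl (n := n)) := continuous_subtype_val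

section

variable {E H M : Type*} [NormedAddCommGroup E] [NormedSpace ℝ E] [TopologicalSpace H]
  {I : ModelWithCorners ℝ E H} [TopologicalSpace M] [ChartedSpace H M]

/-- The global chart is the restriction of a linear projection of the ambient space, so smoothness
can be tested there. -/
theorem contMDiff_of_incl_comp {f : M → Hyp n}
    (hf : ContMDiff I 𝓘(ℝ, ℝ × EuclideanSpace ℝ (Fin n)) ∞ (fun x => (f x).incl)) :
    ContMDiff I (𝓡 n) ∞ f := by
  have h1 : ContMDiff I 𝓘(ℝ, EuclideanSpace ℝ (Fin n)) ∞ (fun x => (f x).incl.2) :=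
    contDiff_snd.contMDiff.comp hf
  have h2 : ContMDiff (𝓡 n) (𝓡 n) ∞ (graphHomeo n).symm := by
    intro y
    exact (contMDiffOn_chart_symm (I := 𝓡 n) (n := ∞) (x := vertex n)).contMDiffAt
      Filter.univ_mem
  exact (h2.comp h1).congr fun x => ((graphHomeo n).symm_apply_apply (f x)).symm

end

/-- The differential of the inclusion `ℍⁿ → ℝ^{1,n}`, with values in `ℝ^{1,n}`. -/
noncomputable def dincl (p : Hyp n) : TangentSpace (𝓡 n) p →L[ℝ] ℝ × EuclideanSpace ℝ (Fin n) :=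
  mfderiv (𝓡 n) 𝓘(ℝ, ℝ × EuclideanSpace ℝ (Fin n)) (incl (n := n)) p

theorem hasMFDerivAt_incl (p : Hyp n) :
    HasMFDerivAt (𝓡 n) 𝓘(ℝ, ℝ × EuclideanSpace ℝ (Fin n)) (incl (n := n)) p (dincl p) :=
  (contMDiff_incl.mdifferentiable (by simp) p).hasMFDerivAt

theorem metric_apply (p : Hyp n) (v w : TangentSpace (𝓡 n) p) :
    metric p v w = lorentzForm n (dincl p v) (dincl p w) := rfl

/-- Differentiate `⟨p, p⟩ = -1`. -/
theorem lorentzForm_dincl_incl (p : Hyp n) (v : TangentSpace (𝓡 n) p) :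
    lorentzForm n (dincl p v) p.incl = 0 := by
  let B := (lorentzForm n).toContinuousBilinearMap
  have hB : HasFDerivAt (fun x => B x x) _ p.incl :=
    B.hasFDerivAt_of_bilinear (hasFDerivAt_id _) (hasFDerivAt_id _)
  have h := hB.hasMFDerivAt.comp p (hasMFDerivAt_incl p)
  have hc : (fun x => B x x) ∘ incl (n := n) = fun _ => (-1 : ℝ) :=
    funext fun q => q.lorentzForm_self
  rw [hc] at h
  have h3 : lorentzForm n p.incl (dincl p v) + lorentzForm n (dincl p v) p.incl = 0 :=
    DFunLike.congr_fun (hasMFDerivAt_unique h (hasMFDerivAt_const (-1 : ℝ) p)) v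
  rw [lorentzForm_comm p.incl] at h3
  linarith

end Hyp

/-! ### Smoothness and tangent vectors of the sphere. -/

namespace USphere

variable {m : ℕ}

theorem contMDiff_coe : ContMDiff (𝓡 m) 𝓘(ℝ, EuclideanSpace ℝ (Fin (m + 1))) ∞
    (fun x : USphere m => (x : EuclideanSpace ℝ (Fin (m + 1)))) :=
  have := Fact.mk (finrank_euclideanSpace_fin (𝕜 := ℝ) (n := m + 1))
  contMDiff_coe_sphere

theorem contMDiff_codRestrict {E H M : Type*} [NormedAddCommGroup E] [NormedSpace ℝ E]
    [TopologicalSpace H] {I : ModelWithCorners ℝ E H} [TopologicalSpace M] [ChartedSpace H M]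
    [IsManifold I ∞ M] {f : M → EuclideanSpace ℝ (Fin (m + 1))}
    (hf : ContMDiff I 𝓘(ℝ, EuclideanSpace ℝ (Fin (m + 1))) ∞ f)
    (hf' : ∀ x, f x ∈ Metric.sphere (0 : EuclideanSpace ℝ (Fin (m + 1))) 1) :
    ContMDiff I (𝓡 m) ∞ (Set.codRestrict f _ hf' : M → USphere m) :=
  have := Fact.mk (finrank_euclideanSpace_fin (𝕜 := ℝ) (n := m + 1))
  hf.codRestrict_sphere hf'

/-- The differential of the inclusion `𝕊ᵐ → ℝ^{m+1}`, with values in `ℝ^{m+1}`. -/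
noncomputable def dcoe (θ : USphere m) :
    TangentSpace (𝓡 m) θ →L[ℝ] EuclideanSpace ℝ (Fin (m + 1)) :=
  mfderiv (𝓡 m) 𝓘(ℝ, EuclideanSpace ℝ (Fin (m + 1)))
    (fun x : USphere m => (x : EuclideanSpace ℝ (Fin (m + 1)))) θ

theorem hasMFDerivAt_coe (θ : USphere m) :
    HasMFDerivAt (𝓡 m) 𝓘(ℝ, EuclideanSpace ℝ (Fin (m + 1)))
      (fun x : USphere m => (x : EuclideanSpace ℝ (Fin (m + 1)))) θ (dcoe θ) :=
  (contMDiff_coe.mdifferentiable (by simp) θ).hasMFDerivAt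

theorem roundMetric_apply (θ : USphere m) (v w : TangentSpace (𝓡 m) θ) :
    roundMetric θ v w = inner ℝ (dcoe θ v) (dcoe θ w) := rfl

theorem inner_self (θ : USphere m) :
    inner ℝ (θ : EuclideanSpace ℝ (Fin (m + 1))) (θ : EuclideanSpace ℝ (Fin (m + 1))) = 1 := by
  simp

theorem inner_dcoe (θ : USphere m) (v : TangentSpace (𝓡 m) θ) :
    inner ℝ (dcoe θ v) (θ : EuclideanSpace ℝ (Fin (m + 1))) = 0 := by
  let B := innerSL ℝ (E := EuclideanSpace ℝ (Fin (m + 1)))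
  have hB : HasFDerivAt (fun x => B x x) _ (θ : EuclideanSpace ℝ (Fin (m + 1))) :=
    B.hasFDerivAt_of_bilinear (hasFDerivAt_id _) (hasFDerivAt_id _)
  have h := hB.hasMFDerivAt.comp θ (hasMFDerivAt_coe θ)
  have hc : (fun x => B x x) ∘ (fun x : USphere m => (x : EuclideanSpace ℝ (Fin (m + 1)))) =
      fun _ => (1 : ℝ) := funext inner_self
  rw [hc] at h
  have h3 : inner ℝ (θ : EuclideanSpace ℝ (Fin (m + 1))) (dcoe θ v) +
      inner ℝ (dcoe θ v) (θ : EuclideanSpace ℝ (Fin (m + 1))) = 0 :=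
    DFunLike.congr_fun (hasMFDerivAt_unique h (hasMFDerivAt_const (1 : ℝ) θ)) v
  rw [real_inner_comm] at h3
  linarith

end USphere

/-! ### The tube map and its pullback metric. -/

namespace Hyp

variable {n k m : ℕ}
  (L : ((ℝ × EuclideanSpace ℝ (Fin k)) × EuclideanSpace ℝ (Fin (m + 1))) ≃ₗ[ℝ]
    (ℝ × EuclideanSpace ℝ (Fin n)))

/-- The point of `ℝ^{1,n}` with spherical coordinates `(q, θ, r)` about `L (ℝ^{1,k} × 0)`. -/
noncomputable def tubeVec (z : (Hyp k × USphere m) × PosLine) : ℝ × EuclideanSpace ℝ (Fin n) :=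
  L (Real.cosh (z.2 : ℝ) • z.1.1.incl,
    Real.sinh (z.2 : ℝ) • (z.1.2 : EuclideanSpace ℝ (Fin (m + 1))))

theorem contMDiff_tubeVec :
    ContMDiff (sphModel k m) 𝓘(ℝ, ℝ × EuclideanSpace ℝ (Fin n)) ∞ (tubeVec L) := by
  have hr : ContMDiff (sphModel k m) 𝓘(ℝ, ℝ) ∞
      (fun z : (Hyp k × USphere m) × PosLine => (z.2 : ℝ)) :=
    contMDiff_subtype_val.comp contMDiff_snd
  have hq : ContMDiff (sphModel k m) 𝓘(ℝ, ℝ × EuclideanSpace ℝ (Fin k)) ∞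
      (fun z : (Hyp k × USphere m) × PosLine => z.1.1.incl) :=
    contMDiff_incl.comp (contMDiff_fst.comp contMDiff_fst)
  have hθ : ContMDiff (sphModel k m) 𝓘(ℝ, EuclideanSpace ℝ (Fin (m + 1))) ∞
      (fun z : (Hyp k × USphere m) × PosLine => (z.1.2 : EuclideanSpace ℝ (Fin (m + 1)))) :=
    USphere.contMDiff_coe.comp (contMDiff_snd.comp contMDiff_fst)
  exact (L.toLinearMap.toContinuousLinearMap.contDiff.contMDiff).comp
    (((Real.contDiff_cosh.contMDiff.comp hr).smul hq).prodMk_space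
      ((Real.contDiff_sinh.contMDiff.comp hr).smul hθ))

theorem mfderiv_tubeVec (p : (Hyp k × USphere m) × PosLine) (v : TangentSpace (sphModel k m) p) :
    let dq := mfderiv (sphModel k m) (𝓡 k)
      (fun z : (Hyp k × USphere m) × PosLine => z.1.1) p v
    let dθ := mfderiv (sphModel k m) (𝓡 m)
      (fun z : (Hyp k × USphere m) × PosLine => z.1.2) p v
    let dr := drForm p.2 (mfderiv (sphModel k m) 𝓘(ℝ, ℝ)
      (fun z : (Hyp k × USphere m) × PosLine => z.2) p v)
    mfderiv (sphModel k m) 𝓘(ℝ, ℝ × EuclideanSpace ℝ (Fin n)) (tubeVec L) p v =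
      L (Real.cosh (p.2 : ℝ) • dincl p.1.1 dq + (Real.sinh (p.2 : ℝ) * dr) • p.1.1.incl,
        Real.sinh (p.2 : ℝ) • USphere.dcoe p.1.2 dθ +
          (Real.cosh (p.2 : ℝ) * dr) • (p.1.2 : EuclideanSpace ℝ (Fin (m + 1)))) := by
  have hr := (((contMDiff_subtype_val (I := 𝓘(ℝ, ℝ)) (n := ∞) (U := PosLine)).mdifferentiable
    (by simp) p.2).hasMFDerivAt).comp p
    ((contMDiff_snd (I := (𝓡 k).prod (𝓡 m)) (J := 𝓘(ℝ, ℝ)) (n := ∞) (M := Hyp k × USphere m)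
      (N := PosLine)).mdifferentiable (by simp) p).hasMFDerivAt
  have hf := contMDiff_fst (I := (𝓡 k).prod (𝓡 m)) (J := 𝓘(ℝ, ℝ)) (n := ∞)
    (M := Hyp k × USphere m) (N := PosLine)
  have hq := (hasMFDerivAt_incl p.1.1).comp p ((contMDiff_fst.comp hf).mdifferentiable
    (by simp) p).hasMFDerivAt
  have hθ := (USphere.hasMFDerivAt_coe p.1.2).comp p ((contMDiff_snd.comp hf).mdifferentiable
    (by simp) p).hasMFDerivAt
  have hg : HasFDerivAt
      (fun y : ℝ × (ℝ × EuclideanSpace ℝ (Fin k)) × EuclideanSpace ℝ (Fin (m + 1)) =>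
        L (Real.cosh y.1 • y.2.1, Real.sinh y.1 • y.2.2)) _
      ((p.2 : ℝ), p.1.1.incl, (p.1.2 : EuclideanSpace ℝ (Fin (m + 1)))) :=
    L.toLinearMap.toContinuousLinearMap.hasFDerivAt.comp _
      ((hasFDerivAt_fst.cosh.smul hasFDerivAt_snd.fst).prodMk
        (hasFDerivAt_fst.sinh.smul hasFDerivAt_snd.snd))
  have hp : HasMFDerivAt (sphModel k m) 𝓘(ℝ, ℝ × (ℝ × EuclideanSpace ℝ (Fin k)) ×
      EuclideanSpace ℝ (Fin (m + 1))) (fun z : (Hyp k × USphere m) × PosLine =>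
      ((z.2 : ℝ), z.1.1.incl, (z.1.2 : EuclideanSpace ℝ (Fin (m + 1))))) p _ :=
    ⟨hr.1.prodMk (hq.1.prodMk hθ.1), hr.2.prodMk (hq.2.prodMk hθ.2)⟩
  have h := (hg.hasMFDerivAt.comp p hp).mfderiv
  exact DFunLike.congr_fun h v

theorem lorentzForm_mfderiv_tubeVec
    (hL : ∀ x y, lorentzForm n (L x) (L y) = lorentzForm k x.1 y.1 + inner ℝ x.2 y.2)
    (p : (Hyp k × USphere m) × PosLine) (v w : TangentSpace (sphModel k m) p) :
    lorentzForm n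
      (mfderiv (sphModel k m) 𝓘(ℝ, ℝ × EuclideanSpace ℝ (Fin n)) (tubeVec L) p v)
      (mfderiv (sphModel k m) 𝓘(ℝ, ℝ × EuclideanSpace ℝ (Fin n)) (tubeVec L) p w) =
      sphMetric k m p v w := by
  have hs : sphMetric k m p v w = Real.cosh (p.2 : ℝ) ^ 2 * metric p.1.1
      (mfderiv (sphModel k m) (𝓡 k) (fun z : (Hyp k × USphere m) × PosLine => z.1.1) p v)
      (mfderiv (sphModel k m) (𝓡 k) (fun z : (Hyp k × USphere m) × PosLine => z.1.1) p w)
    + Real.sinh (p.2 : ℝ) ^ 2 * roundMetric p.1.2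
      (mfderiv (sphModel k m) (𝓡 m) (fun z : (Hyp k × USphere m) × PosLine => z.1.2) p v)
      (mfderiv (sphModel k m) (𝓡 m) (fun z : (Hyp k × USphere m) × PosLine => z.1.2) p w)
    + drForm p.2 (mfderiv (sphModel k m) 𝓘(ℝ, ℝ)
        (fun z : (Hyp k × USphere m) × PosLine => z.2) p v) *
      drForm p.2 (mfderiv (sphModel k m) 𝓘(ℝ, ℝ)
        (fun z : (Hyp k × USphere m) × PosLine => z.2) p w) := rfl
  rw [hs, mfderiv_tubeVec, mfderiv_tubeVec, hL, metric_apply, USphere.roundMetric_apply]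
  simp only [map_add, map_smul, LinearMap.add_apply, LinearMap.smul_apply, inner_add_left,
    inner_add_right, real_inner_smul_left, real_inner_smul_right, lorentzForm_dincl_incl,
    lorentzForm_comm p.1.1.incl (dincl _ _), USphere.inner_dcoe,
    real_inner_comm (USphere.dcoe _ _) (p.1.2 : EuclideanSpace ℝ (Fin (m + 1))), lorentzForm_self,
    USphere.inner_self, smul_eq_mul]
  -- All cross terms have vanished; the coefficient of `dr²` is `-sinh² r + cosh² r = 1`.
  linear_combination (drForm p.2 (mfderiv (sphModel k m) 𝓘(ℝ, ℝ)
        (fun z : (Hyp k × USphere m) × PosLine => z.2) p v) *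
      drForm p.2 (mfderiv (sphModel k m) 𝓘(ℝ, ℝ)
        (fun z : (Hyp k × USphere m) × PosLine => z.2) p w)) * Real.cosh_sq (p.2 : ℝ)

end Hyp

/-! ### Inverse of the tube map, and distances to the copy. -/

namespace Hyp

variable {n k m : ℕ}
  (L : ((ℝ × EuclideanSpace ℝ (Fin k)) × EuclideanSpace ℝ (Fin (m + 1))) ≃ₗ[ℝ]
    (ℝ × EuclideanSpace ℝ (Fin n))) {ι : Hyp k → Hyp n}

/-- Pairing `p` with `ι (vertex k)` reads off minus this coordinate, and the product is at most
`-1`. -/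
theorem symm_fst_fst_pos (hι : ∀ q : Hyp k, L (q.incl, 0) = (ι q).incl)
    (hL : ∀ x y, lorentzForm n (L x) (L y) = lorentzForm k x.1 y.1 + inner ℝ x.2 y.2)
    (p : Hyp n) : 0 < (L.symm p.incl).1.1 := by
  have h := one_le_neg_lorentzForm p (ι (vertex k))
  rw [← hι, ← L.apply_symm_apply p.incl, hL, lorentzForm_comm, lorentzForm_vertex,
    inner_zero_right] at h
  linarith

theorem lorentzForm_symm
    (hL : ∀ x y, lorentzForm n (L x) (L y) = lorentzForm k x.1 y.1 + inner ℝ x.2 y.2)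
    (p : Hyp n) : lorentzForm k (L.symm p.incl).1 (L.symm p.incl).1
      = -(1 + ‖(L.symm p.incl).2‖ ^ 2) := by
  have h := p.lorentzForm_self
  rw [← L.apply_symm_apply p.incl, hL, real_inner_self_eq_norm_sq] at h
  linarith

theorem mem_range_iff (hι : ∀ q : Hyp k, L (q.incl, 0) = (ι q).incl)
    (hL : ∀ x y, lorentzForm n (L x) (L y) = lorentzForm k x.1 y.1 + inner ℝ x.2 y.2)
    (p : Hyp n) : p ∈ Set.range ι ↔ (L.symm p.incl).2 = 0 := by
  constructor
  · rintro ⟨q, rfl⟩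
    rw [← hι, L.symm_apply_apply]
  · intro h
    let q : Hyp k := ⟨(L.symm p.incl).1, by simp [lorentzForm_symm L hL, h],
      symm_fst_fst_pos L hι hL p⟩
    have hq : (q.incl, 0) = L.symm p.incl := Prod.ext rfl h.symm
    exact ⟨q, incl_injective (by rw [← hι, hq, L.apply_symm_apply])⟩

/-- The complement of the totally geodesic copy `ι`, an open subset of `ℍⁿ`. -/
def rangeCompl (hι : ∀ q : Hyp k, L (q.incl, 0) = (ι q).incl)
    (hL : ∀ x y, lorentzForm n (L x) (L y) = lorentzForm k x.1 y.1 + inner ℝ x.2 y.2) :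
    TopologicalSpace.Opens (Hyp n) where
  carrier := (Set.range ι)ᶜ
  is_open' := by
    have h : (Set.range ι)ᶜ = {p : Hyp n | (L.symm p.incl).2 ≠ 0} :=
      Set.ext fun p => not_congr (mem_range_iff L hι hL p)
    rw [h]
    exact isOpen_ne_fun (continuous_snd.comp
      ((L.symm.toLinearMap.continuous_of_finiteDimensional).comp continuous_incl)) continuous_const

theorem symm_snd_ne_zero (hι : ∀ q : Hyp k, L (q.incl, 0) = (ι q).incl)
    (hL : ∀ x y, lorentzForm n (L x) (L y) = lorentzForm k x.1 y.1 + inner ℝ x.2 y.2)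
    (p : rangeCompl L hι hL) : (L.symm (p : Hyp n).incl).2 ≠ 0 :=
  fun h => p.2 ((mem_range_iff L hι hL p).2 h)

theorem lorentzForm_tubeVec (hι : ∀ q : Hyp k, L (q.incl, 0) = (ι q).incl)
    (hL : ∀ x y, lorentzForm n (L x) (L y) = lorentzForm k x.1 y.1 + inner ℝ x.2 y.2)
    (z : (Hyp k × USphere m) × PosLine) (y : Hyp k) :
    lorentzForm n (tubeVec L z) (ι y).incl =
      Real.cosh (z.2 : ℝ) * lorentzForm k z.1.1.incl y.incl := by
  rw [← hι, tubeVec, hL]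
  simp

theorem lorentzForm_tubeVec_self
    (hL : ∀ x y, lorentzForm n (L x) (L y) = lorentzForm k x.1 y.1 + inner ℝ x.2 y.2)
    (z : (Hyp k × USphere m) × PosLine) : lorentzForm n (tubeVec L z) (tubeVec L z) = -1 := by
  rw [tubeVec, hL]
  simp only [map_smul, LinearMap.smul_apply, lorentzForm_self, real_inner_smul_left,
    real_inner_smul_right, USphere.inner_self, smul_eq_mul]
  linear_combination -Real.cosh_sq (z.2 : ℝ)

/-- The point of `ℍⁿ` with spherical coordinates `(q, θ, r)` about the image of `ι`. -/
noncomputable def tubePoint (hι : ∀ q : Hyp k, L (q.incl, 0) = (ι q).incl)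
    (hL : ∀ x y, lorentzForm n (L x) (L y) = lorentzForm k x.1 y.1 + inner ℝ x.2 y.2)
    (z : (Hyp k × USphere m) × PosLine) : Hyp n :=
  ⟨tubeVec L z, lorentzForm_tubeVec_self L hL z,
    fst_pos_of_lorentzForm_neg (lorentzForm_tubeVec_self L hL z) (ι z.1.1) (by
      rw [lorentzForm_tubeVec L hι hL, lorentzForm_self]
      linarith [Real.cosh_pos (z.2 : ℝ)])⟩

theorem tubePoint_mem (hι : ∀ q : Hyp k, L (q.incl, 0) = (ι q).incl)
    (hL : ∀ x y, lorentzForm n (L x) (L y) = lorentzForm k x.1 y.1 + inner ℝ x.2 y.2)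
    (z : (Hyp k × USphere m) × PosLine) : tubePoint L hι hL z ∈ rangeCompl L hι hL := by
  intro h
  have h1 := (mem_range_iff L hι hL _).1 h
  change (L.symm (L _)).2 = 0 at h1
  rw [L.symm_apply_apply, smul_eq_zero, Real.sinh_eq_zero] at h1
  exact h1.elim z.2.2.ne' (ne_zero_of_mem_unit_sphere z.1.2)

/-- The spherical coordinates of a point off the image of `ι`. -/
noncomputable def tubeCoord (hι : ∀ q : Hyp k, L (q.incl, 0) = (ι q).incl)
    (hL : ∀ x y, lorentzForm n (L x) (L y) = lorentzForm k x.1 y.1 + inner ℝ x.2 y.2)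
    (p : rangeCompl L hι hL) : (Hyp k × USphere m) × PosLine :=
  -- With `p = L (a, b)`, necessarily `‖b‖ = sinh r`, so the square root is `cosh r` and `q = a /
  -- cosh r`, `θ = b / ‖b‖`.
  ((⟨(√(1 + ‖(L.symm (p : Hyp n).incl).2‖ ^ 2))⁻¹ • (L.symm (p : Hyp n).incl).1, by
      have h : 0 < 1 + ‖(L.symm (p : Hyp n).incl).2‖ ^ 2 := by positivity
      constructor
      · rw [map_smul, map_smul, LinearMap.smul_apply, lorentzForm_symm L hL, smul_eq_mul,
          smul_eq_mul, ← mul_assoc, ← mul_inv, Real.mul_self_sqrt h.le, mul_neg,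
          inv_mul_cancel₀ h.ne']
      · exact mul_pos (by positivity) (symm_fst_fst_pos L hι hL p)⟩,
    Set.codRestrict (fun p : rangeCompl L hι hL =>
      ‖(L.symm (p : Hyp n).incl).2‖⁻¹ • (L.symm (p : Hyp n).incl).2) _ (fun p => by
        rw [mem_sphere_zero_iff_norm, norm_smul, norm_inv, norm_norm,
          inv_mul_cancel₀ (norm_ne_zero_iff.2 (symm_snd_ne_zero L hι hL p))]) p),
    ⟨Real.arsinh ‖(L.symm (p : Hyp n).incl).2‖,
      Real.arsinh_pos_iff.2 (norm_pos_iff.2 (symm_snd_ne_zero L hι hL p))⟩)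

theorem tubeCoord_tubePoint (hι : ∀ q : Hyp k, L (q.incl, 0) = (ι q).incl)
    (hL : ∀ x y, lorentzForm n (L x) (L y) = lorentzForm k x.1 y.1 + inner ℝ x.2 y.2)
    (z : (Hyp k × USphere m) × PosLine) :
    tubeCoord L hι hL ⟨tubePoint L hι hL z, tubePoint_mem L hι hL z⟩ = z := by
  have hz : L.symm (tubePoint L hι hL z).incl = (Real.cosh (z.2 : ℝ) • z.1.1.incl,
    Real.sinh (z.2 : ℝ) • (z.1.2 : EuclideanSpace ℝ (Fin (m + 1)))) := L.symm_apply_apply _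
  have hs : 0 < Real.sinh (z.2 : ℝ) := Real.sinh_pos_iff.2 z.2.2
  have hn : ‖Real.sinh (z.2 : ℝ) • (z.1.2 : EuclideanSpace ℝ (Fin (m + 1)))‖ =
      Real.sinh (z.2 : ℝ) := by
    rw [norm_smul, norm_eq_of_mem_sphere, mul_one, Real.norm_of_nonneg hs.le]
  refine Prod.ext (Prod.ext (Subtype.ext ?_) (Subtype.ext ?_)) (Subtype.ext ?_)
  · change (√(1 + ‖(L.symm (tubePoint L hι hL z).incl).2‖ ^ 2))⁻¹ •
      (L.symm (tubePoint L hι hL z).incl).1 = z.1.1.incl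
    rw [hz, hn, add_comm, ← Real.cosh_sq, Real.sqrt_sq (Real.cosh_pos _).le,
      inv_smul_smul₀ (Real.cosh_pos _).ne']
  · change ‖(L.symm (tubePoint L hι hL z).incl).2‖⁻¹ • (L.symm (tubePoint L hι hL z).incl).2 =
      (z.1.2 : EuclideanSpace ℝ (Fin (m + 1)))
    rw [hz, hn, inv_smul_smul₀ hs.ne']
  · change Real.arsinh ‖(L.symm (tubePoint L hι hL z).incl).2‖ = z.2
    rw [hz, hn, Real.arsinh_sinh]

theorem tubePoint_tubeCoord (hι : ∀ q : Hyp k, L (q.incl, 0) = (ι q).incl)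
    (hL : ∀ x y, lorentzForm n (L x) (L y) = lorentzForm k x.1 y.1 + inner ℝ x.2 y.2)
    (p : rangeCompl L hι hL) : tubePoint L hι hL (tubeCoord L hι hL p) = p := by
  refine incl_injective ?_
  change L (Real.cosh (Real.arsinh ‖(L.symm (p : Hyp n).incl).2‖) •
      (√(1 + ‖(L.symm (p : Hyp n).incl).2‖ ^ 2))⁻¹ • (L.symm (p : Hyp n).incl).1,
    Real.sinh (Real.arsinh ‖(L.symm (p : Hyp n).incl).2‖) •
      ‖(L.symm (p : Hyp n).incl).2‖⁻¹ • (L.symm (p : Hyp n).incl).2) = _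
  rw [Real.cosh_arsinh, Real.sinh_arsinh, smul_inv_smul₀ (by positivity),
    smul_inv_smul₀ (norm_ne_zero_iff.2 (symm_snd_ne_zero L hι hL p)), L.apply_symm_apply]

theorem contMDiff_tubePoint (hι : ∀ q : Hyp k, L (q.incl, 0) = (ι q).incl)
    (hL : ∀ x y, lorentzForm n (L x) (L y) = lorentzForm k x.1 y.1 + inner ℝ x.2 y.2) :
    ContMDiff (sphModel k m) (𝓡 n) ∞ (tubePoint L hι hL) :=
  contMDiff_of_incl_comp (contMDiff_tubeVec L)

theorem contMDiff_tubeCoord (hι : ∀ q : Hyp k, L (q.incl, 0) = (ι q).incl)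
    (hL : ∀ x y, lorentzForm n (L x) (L y) = lorentzForm k x.1 y.1 + inner ℝ x.2 y.2) :
    ContMDiff (𝓡 n) (sphModel k m) ∞ (tubeCoord L hι hL) := by
  have h0 : ContMDiff (𝓡 n) 𝓘(ℝ, ℝ × EuclideanSpace ℝ (Fin n)) ∞
      (fun p : rangeCompl L hι hL => (p : Hyp n).incl) :=
    contMDiff_incl.comp contMDiff_subtype_val
  have h1 : ContMDiff (𝓡 n) 𝓘(ℝ, ℝ × EuclideanSpace ℝ (Fin k)) ∞
      (fun p : rangeCompl L hι hL => (L.symm (p : Hyp n).incl).1) :=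
    (contDiff_fst.comp L.symm.toLinearMap.toContinuousLinearMap.contDiff).contMDiff.comp h0
  have h2 : ContMDiff (𝓡 n) 𝓘(ℝ, EuclideanSpace ℝ (Fin (m + 1))) ∞
      (fun p : rangeCompl L hι hL => (L.symm (p : Hyp n).incl).2) :=
    (contDiff_snd.comp L.symm.toLinearMap.toContinuousLinearMap.contDiff).contMDiff.comp h0
  -- The norm is smooth only away from `0`; here being off `Y` is what is needed.
  have h3 : ContMDiff (𝓡 n) 𝓘(ℝ, ℝ) ∞
      (fun p : rangeCompl L hι hL => ‖(L.symm (p : Hyp n).incl).2‖) := fun p =>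
    (contDiffAt_norm ℝ (symm_snd_ne_zero L hι hL p)).contMDiffAt.comp p (h2 p)
  have h4 : ContMDiff (𝓡 n) 𝓘(ℝ, ℝ) ∞
      (fun p : rangeCompl L hι hL => ‖(L.symm (p : Hyp n).incl).2‖⁻¹) := fun p =>
    (contDiffAt_inv ℝ (norm_ne_zero_iff.2 (symm_snd_ne_zero L hι hL p))).contMDiffAt.comp p (h3 p)
  have h5 : ContDiff ℝ ∞ (fun x : ℝ => (√(1 + x ^ 2))⁻¹) := by
    refine ContDiff.inv (ContDiff.sqrt ?_ fun x => by positivity) fun x => by positivity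
    exact contDiff_const.add (contDiff_id.pow 2)
  refine ((contMDiff_of_incl_comp ?_).prodMk (USphere.contMDiff_codRestrict (h4.smul h2) _)).prodMk
    ((ContMDiff.subtypeVal_comp_iff PosLine _).1 ?_)
  · exact (h5.contMDiff.comp h3).smul h1
  · exact Real.contDiff_arsinh.contMDiff.comp h3

/-- Spherical coordinates about the image of `ι`. -/
noncomputable def tubeDiffeomorph (hι : ∀ q : Hyp k, L (q.incl, 0) = (ι q).incl)
    (hL : ∀ x y, lorentzForm n (L x) (L y) = lorentzForm k x.1 y.1 + inner ℝ x.2 y.2) :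
    Diffeomorph (sphModel k m) (𝓡 n) ((Hyp k × USphere m) × PosLine) (rangeCompl L hι hL) ∞ where
  toFun z := ⟨tubePoint L hι hL z, tubePoint_mem L hι hL z⟩
  invFun := tubeCoord L hι hL
  left_inv := tubeCoord_tubePoint L hι hL
  right_inv p := Subtype.ext (tubePoint_tubeCoord L hι hL p)
  contMDiff_toFun := (ContMDiff.subtypeVal_comp_iff _ _).1 (contMDiff_tubePoint L hι hL)
  contMDiff_invFun := contMDiff_tubeCoord L hι hL

/-- The inclusion composed with `tubePoint` is `tubeVec`, so the chain rule transfers the ambient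
computation. -/
theorem metric_mfderiv_tubePoint (hι : ∀ q : Hyp k, L (q.incl, 0) = (ι q).incl)
    (hL : ∀ x y, lorentzForm n (L x) (L y) = lorentzForm k x.1 y.1 + inner ℝ x.2 y.2)
    (p : (Hyp k × USphere m) × PosLine) (v w : TangentSpace (sphModel k m) p) :
    metric (tubePoint L hι hL p)
      (mfderiv (sphModel k m) (𝓡 n) (tubePoint L hι hL) p v)
      (mfderiv (sphModel k m) (𝓡 n) (tubePoint L hι hL) p w) = sphMetric k m p v w := by
  have h := ((hasMFDerivAt_incl (tubePoint L hι hL p)).comp p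
    ((contMDiff_tubePoint L hι hL).mdifferentiable (by simp) p).hasMFDerivAt).mfderiv
  rw [metric_apply, ← lorentzForm_mfderiv_tubeVec L hL]
  exact (congrArg₂ (fun x y => lorentzForm n x y) (DFunLike.congr_fun h v)
    (DFunLike.congr_fun h w)).symm

/-- This is the hyperbolic Pythagorean theorem: the spherical component is orthogonal to every `ι
y`. -/
theorem hdist_tubePoint (hι : ∀ q : Hyp k, L (q.incl, 0) = (ι q).incl)
    (hL : ∀ x y, lorentzForm n (L x) (L y) = lorentzForm k x.1 y.1 + inner ℝ x.2 y.2)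
    (z : (Hyp k × USphere m) × PosLine) (y : Hyp k) :
    hdist (tubePoint L hι hL z) (ι y) =
      Real.arcosh (Real.cosh (z.2 : ℝ) * -lorentzForm k z.1.1.incl y.incl) := by
  rw [mul_neg, ← lorentzForm_tubeVec L hι hL]
  rfl

theorem hdist_tubePoint_self (hι : ∀ q : Hyp k, L (q.incl, 0) = (ι q).incl)
    (hL : ∀ x y, lorentzForm n (L x) (L y) = lorentzForm k x.1 y.1 + inner ℝ x.2 y.2)
    (z : (Hyp k × USphere m) × PosLine) :
    hdist (tubePoint L hι hL z) (ι z.1.1) = z.2 := by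
  rw [hdist_tubePoint, lorentzForm_self, neg_neg, mul_one, Real.arcosh_cosh z.2.2.le]

theorem le_hdist_tubePoint (hι : ∀ q : Hyp k, L (q.incl, 0) = (ι q).incl)
    (hL : ∀ x y, lorentzForm n (L x) (L y) = lorentzForm k x.1 y.1 + inner ℝ x.2 y.2)
    (z : (Hyp k × USphere m) × PosLine) (y : Hyp k) :
    z.2 ≤ hdist (tubePoint L hι hL z) (ι y) := by
  have h := one_le_neg_lorentzForm z.1.1 y
  have hc := Real.cosh_pos (z.2 : ℝ)
  rw [hdist_tubePoint]
  calc (z.2 : ℝ) = Real.arcosh (Real.cosh z.2) := (Real.arcosh_cosh z.2.2.le).symm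
    _ ≤ _ := (Real.arcosh_le_arcosh hc (mul_pos hc (by linarith))).2
      (le_mul_of_one_le_right hc.le h)

end Hyp

theorem mainTheorem9 (n k : ℕ) (hk : k < n) (ι : Hyp k → Hyp n)
    (hι : Hyp.IsTotallyGeodesicCopy ι) :
    ∃ U : TopologicalSpace.Opens (Hyp n), (U : Set (Hyp n)) = (Set.range ι)ᶜ ∧
      ∃ Φ : Diffeomorph (sphModel k (n - k - 1)) (𝓡 n)
          ((Hyp k × USphere (n - k - 1)) × PosLine) U ∞,
        (∀ (p : (Hyp k × USphere (n - k - 1)) × PosLine)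
            (v w : TangentSpace (sphModel k (n - k - 1)) p),
          Hyp.metric (Φ p : Hyp n)
              (mfderiv (sphModel k (n - k - 1)) (𝓡 n) (fun z => (Φ z : Hyp n)) p v)
              (mfderiv (sphModel k (n - k - 1)) (𝓡 n) (fun z => (Φ z : Hyp n)) p w)
            = sphMetric k (n - k - 1) p v w) ∧
        (∀ p : (Hyp k × USphere (n - k - 1)) × PosLine,
          Hyp.hdist (Φ p : Hyp n) (ι p.1.1) = p.2 ∧
          ∀ y : Hyp k, (p.2 : ℝ) ≤ Hyp.hdist (Φ p : Hyp n) (ι y)) := by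
  -- Since `k < n`, the truncated subtraction is exact: `k + ((n - k - 1) + 1) = n`.
  obtain ⟨L, hLι, hL⟩ := hι.exists_linearEquiv (m := n - k - 1) (by omega)
  exact ⟨Hyp.rangeCompl L hLι hL, rfl, Hyp.tubeDiffeomorph L hLι hL,
    Hyp.metric_mfderiv_tubePoint L hLι hL,
    fun p => ⟨Hyp.hdist_tubePoint_self L hLι hL p, Hyp.le_hdist_tubePoint L hLι hL p⟩⟩
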